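/- Let $m, d \ge 0$ be integers with $m > d$, let $S^m = \{x \in \mathbb{R}^{m+1} : \|x\| = 1\}$ be the Euclidean unit sphere, and let $f : S^m \to \mathbb{R}^d$ be a continuous map (not assumed to be odd). Then there exist points $p_1, p_2 \in S^m$ with $p_1 \neq p_2$, $p_1 \neq -p_2$ and $f(p_1) = f(p_2)$. -/

import Mathlib

section NoRetraction

open Metric Set MeasureTheory Polynomial
open scoped NNReal Topology ContDiff

/-! Central projection embeds `ℝ^m` in an open hemisphere, which contains no antipodal pair, so it
suffices that no continuous map `ℝ^m → ℝ^d` with `d < m` is injective. If one were, Tietze would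
give a left inverse on the closed unit ball. C¹ approximations of both maps compose to a map near
the identity there, with derivative of rank at most `d`, hence singular. Gluing it to the identity
on the sphere and normalising yields a C¹ map fixing the sphere with singular derivative throughout
the open ball; a volume argument excludes this. -/

theorem det_one_add_eq_sum_lagrange {E : Type*} [AddCommGroup E] [Module ℝ E]
    [FiniteDimensional ℝ E] (s : Finset ℝ) (hs : Module.finrank ℝ E < s.card) (A : E →ₗ[ℝ] E) :
    LinearMap.det (1 + A) =
      ∑ t ∈ s, (Lagrange.basis s id t).eval 1 * LinearMap.det (1 + t • A) := by
  classical
  let b := Module.finBasis ℝ E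
  set M := LinearMap.toMatrix b b A
  set p : ℝ[X] := Matrix.det ((X : ℝ[X]) • M.map C + (1 : Matrix _ _ ℝ).map C)
  have hp : ∀ t : ℝ, p.eval t = LinearMap.det (1 + t • A) := by
    intro t
    rw [← LinearMap.det_toMatrix b, ← Polynomial.coe_evalRingHom, RingHom.map_det]
    congr 1
    ext i j
    by_cases hij : i = j <;>
      simp [M, LinearMap.toMatrix_one, hij, add_comm (1 : ℝ), mul_comm t]
  have hdeg : p.degree < s.card :=
    (Polynomial.degree_le_natDegree.trans (WithBot.coe_le_coe.2
      (Polynomial.natDegree_det_X_add_C_le M 1))).trans_lt (by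
        rw [Fintype.card_fin]
        exact WithBot.coe_lt_coe.2 hs)
  have h := congrArg (Polynomial.eval 1)
    (Lagrange.eq_interpolate (v := id) (Set.injOn_id (s : Set ℝ)) hdeg)
  simpa [Lagrange.interpolate_apply, Polynomial.eval_finsetSum, hp, mul_comm] using h

theorem exists_mem_segment_norm_eq_one {E : Type*} [NormedAddCommGroup E] [NormedSpace ℝ E]
    {x y : E} (hx : ‖x‖ ≤ 1) (hy : 1 ≤ ‖y‖) : ∃ z, ‖z‖ = 1 ∧ ‖x - z‖ ≤ ‖x - y‖ := by
  have hc : ContinuousOn (fun s : ℝ => ‖AffineMap.lineMap x y s‖) (Icc 0 1) := by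
    apply Continuous.continuousOn
    exact (AffineMap.lineMap_continuous).norm
  obtain ⟨s, hs, hs1⟩ := intermediate_value_Icc zero_le_one hc
    (show (1 : ℝ) ∈ Icc _ _ by simpa using ⟨hx, hy⟩)
  refine ⟨_, hs1, ?_⟩
  rw [← dist_eq_norm, dist_left_lineMap, ← dist_eq_norm, Real.norm_of_nonneg hs.1]
  exact mul_le_of_le_one_left dist_nonneg hs.2

/-- A segment leaving the ball crosses the sphere, where `g` vanishes, so the constant does not
grow. -/
theorem exists_lipschitzWith_extension_zero {E : Type*} [NormedAddCommGroup E] [NormedSpace ℝ E]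
    {K : ℝ≥0} {g : E → E} (hg : LipschitzOnWith K g (closedBall 0 1))
    (h0 : ∀ x, ‖x‖ = 1 → g x = 0) :
    LipschitzWith K (indicator (closedBall 0 1) g) := by
  have key : ∀ x y : E, ‖x‖ ≤ 1 → 1 < ‖y‖ → dist (g x) 0 ≤ K * dist x y := by
    intro x y hx hy
    obtain ⟨z, hz, hxz⟩ := exists_mem_segment_norm_eq_one hx hy.le
    rw [← h0 z hz]
    refine (hg.dist_le_mul x (by simpa using hx) z (by simpa using hz.le)).trans ?_
    gcongr
    simpa [dist_eq_norm] using hxz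
  refine LipschitzWith.of_dist_le_mul fun x y => ?_
  by_cases hx : x ∈ closedBall (0 : E) 1 <;> by_cases hy : y ∈ closedBall (0 : E) 1
  · simpa [indicator_of_mem, hx, hy] using hg.dist_le_mul x hx y hy
  · rw [indicator_of_mem hx, indicator_of_notMem hy]
    exact key x y (by simpa using hx) (by simpa using hy)
  · rw [indicator_of_mem hy, indicator_of_notMem hx, dist_comm, dist_comm x]
    exact key y x (by simpa using hy) (by simpa using hx)
  · rw [indicator_of_notMem hx, indicator_of_notMem hy, dist_self]
    positivity

theorem bijective_add_of_lipschitzWith {E : Type*} [NormedAddCommGroup E] [CompleteSpace E]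
    {K : ℝ≥0} (hK : K < 1) {g : E → E} (hg : LipschitzWith K g) :
    Function.Bijective fun x => x + g x := by
  constructor
  · intro x y hxy
    have h1 : dist x y = dist (g x) (g y) := by
      have : x - y = g y - g x := by
        have hxy : x + g x = y + g y := hxy
        rw [sub_eq_sub_iff_add_eq_add, hxy, add_comm]
      rw [dist_eq_norm, this, dist_comm, dist_eq_norm]
    have h2 := hg.dist_le_mul x y
    have hK' : (K : ℝ) < 1 := by exact_mod_cast hK
    have h3 : dist x y ≤ 0 := by nlinarith [dist_nonneg (x := x) (y := y)]
    exact dist_le_zero.1 h3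
  · intro y
    have hc : ContractingWith K fun x => y - g x := by
      refine ⟨hK, LipschitzWith.of_dist_le_mul fun a b => ?_⟩
      rw [dist_sub_left]
      exact hg.dist_le_mul a b
    have h : y - g hc.fixedPoint = hc.fixedPoint := hc.fixedPoint_isFixedPt
    exact ⟨hc.fixedPoint, (sub_eq_iff_eq_add.1 h).symm⟩

theorem image_ball_eq_of_bijective {E : Type*} [SeminormedAddCommGroup E]
    {w : E → E} (hw : Function.Bijective w) (h : ∀ x ∉ ball (0 : E) 1, w x = x) :
    w '' ball 0 1 = ball 0 1 := by
  ext y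
  constructor
  · rintro ⟨x, hx, rfl⟩
    by_contra hy
    rw [hw.1 (h _ hy)] at hy
    exact hy hx
  · intro hy
    obtain ⟨x, rfl⟩ := hw.2 y
    refine ⟨x, ?_, rfl⟩
    by_contra hx
    rw [h x hx] at hy
    exact hx hy

variable {E : Type*}

theorem exists_pos_forall_det_one_add_pos [NormedAddCommGroup E] [NormedSpace ℝ E]
    [FiniteDimensional ℝ E] :
    ∃ δ > 0, ∀ A : E →L[ℝ] E, ‖A‖ < δ → 0 < (1 + A).det := by
  have hc : Continuous fun A : E →L[ℝ] E => (1 + A).det :=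
    ContinuousLinearMap.continuous_det.comp (continuous_const.add continuous_id)
  have h0 : (0 : ℝ) < (1 + (0 : E →L[ℝ] E)).det := by
    simp [ContinuousLinearMap.det]
  obtain ⟨δ, hδ, h⟩ := Metric.eventually_nhds_iff.1 
    (continuousAt_const.eventually_lt hc.continuousAt h0)
  exact ⟨δ, hδ, fun A hA => h (by simpa using hA)⟩

/-- With `g = r - id`, the integral of `det (1 + t Dg)` over the ball is a polynomial in `t`. For
small `t > 0`, `id + t g` permutes the ball, so this polynomial is constantly its volume; at `t = 1`
it would vanish. -/
theorem not_forall_det_fderiv_eq_zero_of_eqOn_sphere [NormedAddCommGroup E] [NormedSpace ℝ E]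
    [FiniteDimensional ℝ E] {r : E → E} (hr : ContDiff ℝ 1 r) (hr1 : ∀ x, ‖x‖ = 1 → r x = x) :
    ¬ ∀ x ∈ ball (0 : E) 1, (fderiv ℝ r x).det = 0 := by
  intro hdet
  borelize E
  let μ : Measure E := Measure.addHaar
  let g : E → E := fun x => r x - x
  have hg : ContDiff ℝ 1 g := hr.sub contDiff_id
  have hgd : Differentiable ℝ g := hg.differentiable one_ne_zero
  have hg' : Continuous (fderiv ℝ g) := hg.continuous_fderiv one_ne_zero
  obtain ⟨C, hC⟩ := (isCompact_closedBall (0 : E) 1).exists_bound_of_continuousOn hg'.continuousOn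
  have hC0 : 0 ≤ C := (norm_nonneg _).trans (hC 0 (by simp))
  lift C to ℝ≥0 using hC0
  have hL : LipschitzWith C (indicator (closedBall 0 1) g) :=
    exists_lipschitzWith_extension_zero
      ((convex_closedBall 0 1).lipschitzOnWith_of_nnnorm_fderiv_le (𝕜 := ℝ) (fun x _ => hgd x)
        fun x hx => hC x hx) fun x hx => by simp [g, hr1 x hx]
  obtain ⟨δ, hδ, hpos⟩ := exists_pos_forall_det_one_add_pos (E := E)
  -- For `t < η`, `t * C < 1` makes `t g` a contraction and `t * C < δ` makes the Jacobian positive.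
  set η : ℝ := min δ 1 / (C + 1)
  have hη : 0 < η := by positivity
  have hηC : ∀ t ∈ Ioo 0 η, t * C < min δ 1 := by
    intro t ht
    have h1 : t * (C + 1) < min δ 1 := (lt_div_iff₀ (by positivity)).1 ht.2
    nlinarith [ht.1]
  have hvol : ∀ t ∈ Ioo 0 η,
      ∫ x in ball (0 : E) 1, (1 + t • fderiv ℝ g x).det ∂μ = μ.real (ball 0 1) := by
    intro t ht
    let w : E → E := fun x => x + t • indicator (closedBall 0 1) g x
    have hw : Function.Bijective w := by
      refine bijective_add_of_lipschitzWith (K := t.toNNReal * C) ?_ ?_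
      · rw [← NNReal.coe_lt_coe]
        simpa [ht.1.le] using (hηC t ht).trans_le (min_le_right _ _)
      · refine LipschitzWith.of_dist_le_mul fun x y => ?_
        rw [dist_smul₀, Real.norm_of_nonneg ht.1.le, NNReal.coe_mul, Real.coe_toNNReal _ ht.1.le,
          mul_assoc]
        exact mul_le_mul_of_nonneg_left (hL.dist_le_mul x y) ht.1.le
    have hw1 : ∀ x ∉ ball (0 : E) 1, w x = x := by
      intro x hx
      have : indicator (closedBall 0 1) g x = 0 := by
        by_cases hx' : x ∈ closedBall (0 : E) 1
        · have : ‖x‖ = 1 := le_antisymm (by simpa using hx') (by simpa using hx)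
          simp [indicator_of_mem hx', g, hr1 x this]
        · exact indicator_of_notMem hx' g
      simp [w, this]
    have hwd : ∀ x ∈ ball (0 : E) 1,
        HasFDerivWithinAt w (1 + t • fderiv ℝ g x) (ball 0 1) x := by
      intro x hx
      have : HasFDerivAt (fun x => x + t • g x) (1 + t • fderiv ℝ g x) x :=
        (hasFDerivAt_id x).add ((hgd x).hasFDerivAt.const_smul t)
      refine this.hasFDerivWithinAt.congr (fun y hy => ?_) ?_
      · simp [w, indicator_of_mem (ball_subset_closedBall hy)]
      · simp [w, indicator_of_mem (ball_subset_closedBall hx)]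
    have h := integral_image_eq_integral_abs_det_fderiv_smul μ measurableSet_ball hwd hw.1.injOn
      (fun _ => (1 : ℝ))
    rw [image_ball_eq_of_bijective hw hw1] at h
    simp only [integral_const, smul_eq_mul, mul_one, measureReal_restrict_apply_univ] at h
    rw [h]
    refine setIntegral_congr_fun measurableSet_ball fun x hx => ?_
    refine (abs_of_pos (hpos _ ?_)).symm
    rw [norm_smul, Real.norm_of_nonneg ht.1.le]
    exact (mul_le_mul_of_nonneg_left (hC x (ball_subset_closedBall hx)) ht.1.le).trans_lt
      ((hηC t ht).trans_le (min_le_left _ _))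
  -- Enough nodes to interpolate a polynomial of degree at most `finrank ℝ E` and evaluate it at 1.
  obtain ⟨s, hsη, hs⟩ := (Ioo_infinite hη).exists_subset_card_eq (Module.finrank ℝ E + 1)
  have hint : ∀ t : ℝ, Integrable (fun x => (1 + t • fderiv ℝ g x).det)
      (μ.restrict (ball 0 1)) := by
    intro t
    have hc : Continuous fun x => (1 + t • fderiv ℝ g x).det :=
      ContinuousLinearMap.continuous_det.comp (continuous_const.add (hg'.const_smul t))
    exact (hc.continuousOn.integrableOn_compact (isCompact_closedBall 0 1)).mono_set
      ball_subset_closedBall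
  have hzero : ∫ x in ball (0 : E) 1, (1 + fderiv ℝ g x).det ∂μ = 0 := by
    refine setIntegral_eq_zero_of_forall_eq_zero fun x hx => ?_
    rw [← hdet x hx]
    congr 1
    have : fderiv ℝ g x = fderiv ℝ r x - 1 := by
      have := fderiv_fun_sub (𝕜 := ℝ) (hr.differentiable one_ne_zero x) differentiableAt_id
      simpa [g, fderiv_id] using! this
    rw [this, add_sub_cancel]
  have hsum : ∫ x in ball (0 : E) 1, (1 + fderiv ℝ g x).det ∂μ = μ.real (ball 0 1) := by
    have h1 : ∀ x, (1 + fderiv ℝ g x).det =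
        ∑ t ∈ s, (Lagrange.basis s id t).eval 1 * (1 + t • fderiv ℝ g x).det := fun x =>
      det_one_add_eq_sum_lagrange s (by omega) (fderiv ℝ g x : E →ₗ[ℝ] E)
    simp_rw [h1]
    rw [integral_finsetSum _ fun t _ => (hint t).const_mul _]
    simp_rw [integral_const_mul]
    rw [Finset.sum_congr rfl fun t ht => by rw [hvol t (hsη ht)], ← Finset.sum_mul]
    have := congrArg (Polynomial.eval 1) (Lagrange.sum_basis (v := id) (s := s)
      (Set.injOn_id _) (Finset.card_pos.1 (by omega)))
    rw [Polynomial.eval_finsetSum, Polynomial.eval_one] at this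
    rw [this, one_mul]
  have hball : 0 < μ.real (ball (0 : E) 1) :=
    ENNReal.toReal_pos (measure_ball_pos μ _ one_pos).ne' measure_ball_lt_top.ne
  linarith

theorem det_fderiv_eq_zero_of_norm_eventuallyEq_one [NormedAddCommGroup E] [InnerProductSpace ℝ E]
    [FiniteDimensional ℝ E] {r : E → E} {x : E} (hr : DifferentiableAt ℝ r x)
    (h : ∀ᶠ y in 𝓝 x, ‖r y‖ = 1) : (fderiv ℝ r x).det = 0 := by
  by_contra hdet
  have hu : IsUnit (fderiv ℝ r x : E →ₗ[ℝ] E) :=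
    (LinearMap.isUnit_iff_isUnit_det _).2 (isUnit_iff_ne_zero.2 hdet)
  -- Along `v`, the locally constant `‖r‖ ^ 2` would have derivative `2 ‖r x‖ ^ 2 = 2`.
  obtain ⟨v, hv⟩ := ((Module.End.isUnit_iff _).1 hu).2 (r x)
  have hv : fderiv ℝ r x v = r x := hv
  have h1 : HasFDerivAt (fun y => ‖r y‖ ^ 2) (2 • (innerSL ℝ (r x)).comp (fderiv ℝ r x)) x :=
    hr.hasFDerivAt.norm_sq
  have h2 : HasFDerivAt (fun y => ‖r y‖ ^ 2) (0 : E →L[ℝ] ℝ) x :=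
    (hasFDerivAt_const (1 : ℝ) x).congr_of_eventuallyEq (by
      filter_upwards [h] with y hy
      simp [hy])
  have h3 := congrArg (fun L : E →L[ℝ] ℝ => L v) (h1.unique h2)
  simp [hv, h.self_of_nhds] at h3

/-! ### Singular C¹ maps near the identity -/

theorem exists_contDiff_eq_inv_norm_smul [NormedAddCommGroup E] [InnerProductSpace ℝ E]
    [FiniteDimensional ℝ E] {ε : ℝ} (hε : 0 < ε) :
    ∃ q : E → E, ContDiff ℝ 1 q ∧ ∀ x, ε ≤ ‖x‖ → q x = ‖x‖⁻¹ • x := by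
  let ψ : ContDiffBump (0 : E) := ⟨ε / 2, ε, half_pos hε, half_lt_self hε⟩
  refine ⟨fun x => (1 - ψ x) • (‖x‖⁻¹ • x), contDiff_iff_contDiffAt.2 fun x => ?_, fun x hx => ?_⟩
  · rcases eq_or_ne x 0 with rfl | hx
    · refine contDiffAt_const (c := (0 : E)) |>.congr_of_eventuallyEq ?_
      filter_upwards [ψ.eventuallyEq_one] with y hy
      simp [hy]
    · exact (contDiffAt_const.sub ψ.contDiff.contDiffAt).smul
        (((contDiffAt_norm ℝ hx).inv (norm_ne_zero_iff.2 hx)).smul contDiffAt_id)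
  · simp [ψ.zero_of_le_dist (by simpa using hx : ψ.rOut ≤ dist x 0)]

theorem not_forall_det_fderiv_eq_zero_of_near_id [NormedAddCommGroup E] [InnerProductSpace ℝ E]
    [FiniteDimensional ℝ E] {h : E → E} (hh : ContDiff ℝ 1 h)
    (hid : ∀ x ∈ closedBall (0 : E) 1, ‖h x - x‖ ≤ 1 / 4) :
    ¬ ∀ x, (fderiv ℝ h x).det = 0 := by
  intro hdet
  let χ : ContDiffBump (0 : E) := ⟨1 / 2, 1, by norm_num, by norm_num⟩
  let w : E → E := fun x => x + χ x • (h x - x)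
  have hw : ContDiff ℝ 1 w := contDiff_id.add (χ.contDiff.smul (hh.sub contDiff_id))
  have hw1 : ∀ x, ‖x‖ = 1 → w x = x := by
    intro x hx
    simp [w, χ.zero_of_le_dist (by simp [χ, hx] : χ.rOut ≤ dist x 0)]
  have hw2 : ∀ x, ‖x‖ ≤ 1 → ‖w x‖ < 1 / 4 → ‖x‖ < 1 / 2 := by
    intro x hx hwx
    have h1 : ‖χ x • (h x - x)‖ ≤ 1 / 4 := by
      rw [norm_smul, Real.norm_of_nonneg χ.nonneg]
      exact (mul_le_of_le_one_left (norm_nonneg _) χ.le_one).trans (hid x (by simpa using hx))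
    have h2 : x = w x - χ x • (h x - x) := by simp [w]
    have h3 := norm_sub_le (w x) (χ x • (h x - x))
    rw [← h2] at h3
    linarith
  obtain ⟨q, hq, hq1⟩ := exists_contDiff_eq_inv_norm_smul (E := E) (ε := 1 / 8) (by norm_num)
  refine not_forall_det_fderiv_eq_zero_of_eqOn_sphere (hq.comp hw) (fun x hx => ?_) fun x hx => ?_
  · rw [Function.comp_apply, hw1 x hx, hq1 x (by rw [hx]; norm_num), hx, inv_one, one_smul]
  · have hx : ‖x‖ < 1 := by simpa using hx
    -- If `w x` is small, then `w = h` near `x` and `h` supplies singularity; otherwise `q ∘ w` has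
    -- unit norm near `x`.
    rcases lt_or_ge ‖w x‖ (1 / 4) with hwx | hwx
    · have hx2 := hw2 x hx.le hwx
      have hev : q ∘ w =ᶠ[𝓝 x] q ∘ h := by
        filter_upwards [isOpen_ball.mem_nhds (by simpa using hx2 : x ∈ ball (0 : E) (1 / 2))]
          with y hy
        simp [w, χ.one_of_mem_closedBall (ball_subset_closedBall hy)]
      rw [hev.fderiv_eq, fderiv_comp x (hq.differentiable one_ne_zero _)
        (hh.differentiable one_ne_zero x)]
      have := hdet x
      simp only [ContinuousLinearMap.det] at this ⊢
      rw [ContinuousLinearMap.toLinearMap_comp, LinearMap.det_comp, this, mul_zero]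
    · refine det_fderiv_eq_zero_of_norm_eventuallyEq_one
        ((hq.comp hw).differentiable one_ne_zero x) ?_
      have hev : ∀ᶠ y in 𝓝 x, 1 / 8 < ‖w y‖ :=
        continuousAt_const.eventually_lt hw.continuous.norm.continuousAt (by linarith)
      filter_upwards [hev] with y hy
      rw [Function.comp_apply, hq1 _ hy.le, norm_smul, norm_inv, norm_norm,
        inv_mul_cancel₀ (by linarith)]

/-! ### Non-injectivity into lower dimension -/

theorem not_injective_of_continuous_of_finrank_lt {F : Type*}
    [NormedAddCommGroup E] [InnerProductSpace ℝ E] [FiniteDimensional ℝ E]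
    [NormedAddCommGroup F] [NormedSpace ℝ F] [FiniteDimensional ℝ F]
    (hEF : Module.finrank ℝ F < Module.finrank ℝ E) {f : E → F} (hf : Continuous f) :
    ¬ Function.Injective f := by
  intro hinj
  set B : Set E := closedBall 0 1
  have hB : IsCompact B := isCompact_closedBall 0 1
  have : CompactSpace B := isCompact_iff_compactSpace.1 hB
  have hemb : Topology.IsClosedEmbedding (fun x : B => f x) :=
    (hf.comp continuous_subtype_val).isClosedEmbedding
      (hinj.comp Subtype.val_injective)
  have : TietzeExtension E := RCLike.instTietzeExtensionTVS (𝕜 := ℝ)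
  obtain ⟨g, hg⟩ := ContinuousMap.exists_extension' hemb
    (⟨Subtype.val, continuous_subtype_val⟩ : C(B, E))
  have hgf : ∀ x ∈ B, g (f x) = x := fun x hx => congrFun hg ⟨x, hx⟩
  obtain ⟨p, hp, hpg, -⟩ := g.continuous.exists_contDiff_approx 1
    (continuous_const (y := (1 / 8 : ℝ))) (fun _ => by norm_num)
  -- The thickening leaves room for `k` on `B` inside a compact set where `p` is uniformly
  -- continuous.
  have hK : IsCompact (cthickening 1 (f '' B)) := (hB.image hf).cthickening
  obtain ⟨δ, hδ, hpδ⟩ := Metric.uniformContinuousOn_iff.1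
    (hK.uniformContinuousOn_of_continuous hp.continuous.continuousOn) (1 / 8) (by norm_num)
  obtain ⟨k, hk, hkf, -⟩ := hf.exists_contDiff_approx 1
    (continuous_const (y := min δ 1)) (fun _ => by positivity)
  refine not_forall_det_fderiv_eq_zero_of_near_id (hp.comp hk) (fun x hx => ?_) fun x => ?_
  · have hfx : f x ∈ f '' B := mem_image_of_mem f hx
    have h1 : dist (p (k x)) (p (f x)) < 1 / 8 :=
      hpδ _ (mem_cthickening_of_dist_le _ _ _ _ hfx ((hkf x).le.trans (min_le_right _ _)))
        _ (self_subset_cthickening _ hfx) ((hkf x).trans_le (min_le_left _ _))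
    have h2 := hpg (f x)
    rw [hgf x hx] at h2
    rw [← dist_eq_norm]
    have := dist_triangle (p (k x)) (p (f x)) x
    simp only [Function.comp_apply]
    linarith
  · by_contra hdet
    rw [fderiv_comp x (hp.differentiable one_ne_zero _) (hk.differentiable one_ne_zero x)] at hdet
    have hu := (Module.End.isUnit_iff _).1
      ((LinearMap.isUnit_iff_isUnit_det _).2 (isUnit_iff_ne_zero.2 hdet))
    have hi : Function.Injective (fderiv ℝ k x : E →ₗ[ℝ] F) := by
      refine Function.Injective.of_comp (f := fderiv ℝ p (k x)) ?_
      exact hu.1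
    exact hEF.not_ge (LinearMap.finrank_le_finrank_of_injective hi)

end NoRetraction

/-! ### Reduction to a hemisphere -/

theorem mainTheorem3 (m d : ℕ) (hmd : d < m)
    (f : Metric.sphere (0 : EuclideanSpace ℝ (Fin (m + 1))) 1 → EuclideanSpace ℝ (Fin d))
    (hf : Continuous f) :
    ∃ p₁ p₂ : Metric.sphere (0 : EuclideanSpace ℝ (Fin (m + 1))) 1,
      p₁ ≠ p₂ ∧ p₁ ≠ -p₂ ∧ f p₁ = f p₂ := by
  let u : EuclideanSpace ℝ (Fin m) → EuclideanSpace ℝ (Fin (m + 1)) := fun x =>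
    WithLp.toLp 2 (Fin.cons 1 x : Fin (m + 1) → ℝ)
  have hu : Continuous u := by
    refine (PiLp.continuous_toLp 2 _).comp (continuous_pi fun i => ?_)
    refine Fin.cases ?_ (fun j => ?_) i
    · simpa using continuous_const
    · simp only [Fin.cons_succ]
      fun_prop
  have hu0 : ∀ x, u x 0 = 1 := fun x => rfl
  have hus : ∀ x j, u x (Fin.succ j) = x j := fun x j => rfl
  have hpos : ∀ x, 0 < ‖u x‖ := fun x => norm_pos_iff.2 fun h => by
    have := hu0 x
    simp [h] at this
  let e : EuclideanSpace ℝ (Fin m) → Metric.sphere (0 : EuclideanSpace ℝ (Fin (m + 1))) 1 :=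
    fun x => ⟨‖u x‖⁻¹ • u x, by simp [norm_smul, (hpos x).ne']⟩
  have he : Continuous e :=
    ((hu.norm.inv₀ fun x => (hpos x).ne').smul hu).subtype_mk _
  have hval : ∀ x i, (e x : EuclideanSpace ℝ (Fin (m + 1))) i = ‖u x‖⁻¹ * u x i := fun x i => rfl
  obtain ⟨x, y, hxy, hne⟩ : ∃ x y, f (e x) = f (e y) ∧ x ≠ y := by
    simpa [Function.Injective] using
      not_injective_of_continuous_of_finrank_lt (by simpa using hmd) (hf.comp he)
  refine ⟨e x, e y, fun h => hne ?_, fun h => ?_, hxy⟩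
  · have hc : ∀ i, ‖u x‖⁻¹ * u x i = ‖u y‖⁻¹ * u y i := fun i => by rw [← hval, h, hval]
    have h0 := hc 0
    rw [hu0, hu0, mul_one, mul_one] at h0
    ext j
    have hj := hc j.succ
    rw [hus, hus, h0] at hj
    exact mul_left_cancel₀ (inv_pos.2 (hpos y)).ne' hj
  -- Points of the hemisphere have positive zeroth coordinate.
  · have h0 : ‖u x‖⁻¹ * u x 0 = -(‖u y‖⁻¹ * u y 0) := by
      rw [← hval, h]
      rfl
    rw [hu0, hu0, mul_one, mul_one] at h0
    linarith [inv_pos.2 (hpos x), inv_pos.2 (hpos y)]
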